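/- **Setting.** There are $n\ge 1$ clients; client $i$ holds a local data set $D_i$, $m=\frac1n\sum_{i=1}^n|D_i|$ is the average size, and $nm=\sum_i|D_i|\ge 1$ is the total size. All samples are independent, and those of client $i$ are drawn from a probability distribution $\mathcal D_i$; the test distribution is $\mathcal D=\sum_i\frac{|D_i|}{nm}\mathcal D_i$ (so the training data are i.i.d. from $\mathcal D$ if $\mathcal D_1=\dots=\mathcal D_n$). Let $F(\theta;z)\in[0,1]$ be a measurable loss, $\theta\in\mathbb R^d$. For a distribution $Q$ on $\mathbb R^d$ put $R(Q)=\mathbb E_{\theta\sim Q}\mathbb E_{z\sim\mathcal D}F(\theta;z)$ and $\hat R(Q)=\mathbb E_{\theta\sim Q}\mathbb E_{z\sim\hat{\mathcal D}}F(\theta;z)$, where $\hat{\mathcal D}$ is the empirical distribution of $\bigcup_i D_i$. Let $T\ge 1$ be the number of rounds, $\eta>0$ the learning rate, $k_{Fed}m$ the local batch size, $\frac1m\le k_{Fed}\le 1$, and let $\theta^*\in\mathbb R^d$ be a fixed point (the minimum, not depending on the training sample). A *local model* consists, for every client $i$, of a positive semidefinite matrix $A_i$ (the Jacobian of the loss gradient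 around $\theta^*$) and a matrix $B_i\in\mathbb R^{d\times d}$ such that $C_i=B_iB_i^\top$ is the covariance of the gradient noise of one sample. Put $\bar A=\frac1n\sum_iA_i$, $\bar B=\frac1n\sum_iB_i$, $\bar C=\bar B\bar B^\top$, and assume that $\bar A$ is invertible. Federated SGD is modelled by the Ornstein–Uhlenbeck process $$\theta(t)=\theta^*+e^{-T\bar At}(\theta(0)-\theta^*)+T\sqrt{\frac{\eta}{k_{Fed}m}}\int_0^te^{-T\bar A(t-t')}\bar B\,dW(t'),$$ with $W$ a standard Brownian motion; $Q_{Fed}$ is a stationary distribution of this process (an invariant probability measure of its transition laws), and $\Sigma_{Fed}$ is the covariance matrix of $Q_{Fed}$. Assume that $\bar A\,\Sigma_{Fed}=\Sigma_{Fed}\,\bar A$. **Theorem.** 1. $\displaystyle\Sigma_{Fed}=\frac{T\eta}{2k_{Fed}m}\,\bar C\bar A^{-1}$. 2. For every $\delta\in(0,1)$, with probability at least $1-\delta$ over the distributed training set, the following holds simultaneously for all local models as above for which $\bar C$ is invertible (which may therefore depend on the training set) and their stationary distributions $Q_{Fed}$: $$R(Q_{Fed})-\hat R(Q_{Fed})\le\sqrt{\frac{d\log\frac{2k_{Fed}m}{T\eta}-\log\det(\bar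 C\bar A^{-1})+\frac{T\eta}{2k_{Fed}m}\operatorname{tr}(\bar C\bar A^{-1})-d+2\log\frac1\delta+2\log(nm)+4}{4nm-2}}.$$ -/

import Mathlib

open MeasureTheory ProbabilityTheory
open scoped Matrix ENNReal

noncomputable section

namespace FedPAC

/-! ### Risks -/

/-- `E_{θ ∼ Q} E_{z ∼ μ} F(θ; z)`: the risk of a random parameter `θ ∼ Q` with respect to a data
distribution `μ`. It is the expected risk `R(Q)` when `μ` is the distribution of the test data, and
the empirical risk `R̂(Q)` when `μ` is the empirical distribution of the training data. -/
def risk {d : ℕ} {Z : Type*} [MeasurableSpace Z] (F : EuclideanSpace ℝ (Fin d) → Z → ℝ)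
    (μ : Measure Z) (Q : Measure (EuclideanSpace ℝ (Fin d))) : ℝ :=
  ∫ θ, ∫ z, F θ z ∂μ ∂Q

/-! ### Distributed data sets

Client `i` holds the `M i` samples `S ⟨i, 0⟩, …, S ⟨i, M i - 1⟩`, so a distributed data set is a
function `S : (Σ i, Fin (M i)) → Z`. -/

/-- The average size `m = (1/n) ∑ i, |D_i|` of the local data sets; `n * m` is the total size. -/
def avgSize {n : ℕ} (M : Fin n → ℕ) : ℝ := (∑ i, (M i : ℝ)) / n

/-- The law of the distributed training set: all samples are independent, and the samples of
client `i` have the law `D i`. -/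
def trainLaw {n : ℕ} (M : Fin n → ℕ) {Z : Type*} [MeasurableSpace Z] (D : Fin n → Measure Z) :
    Measure ((Σ i, Fin (M i)) → Z) :=
  Measure.pi fun p => D p.1

/-- The global data distribution: the mixture of the client distributions in the proportions of
the local data sets. It equals `D₀` if every `D i` is equal to `D₀`. -/
def testLaw {n : ℕ} (M : Fin n → ℕ) {Z : Type*} [MeasurableSpace Z] (D : Fin n → Measure Z) :
    Measure Z :=
  ∑ i, ((M i : ℝ≥0∞) / ((∑ j, M j : ℕ) : ℝ≥0∞)) • D i

/-- The empirical distribution of the union of the local data sets. -/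
def empLaw {n : ℕ} {M : Fin n → ℕ} {Z : Type*} [MeasurableSpace Z] (S : (Σ i, Fin (M i)) → Z) :
    Measure Z :=
  ((∑ j, M j : ℕ) : ℝ≥0∞)⁻¹ • ∑ p, Measure.dirac (S p)

/-! ### Ornstein–Uhlenbeck processes and their stationary laws -/

/-- `∫₀ˢ e^{-uK} D Dᵀ (e^{-uK})ᵀ du`, the covariance matrix of the Gaussian random vector
`∫₀ˢ e^{-(s-u)K} D dW(u)`. The integral is taken entrywise. -/
def ouCov {d : ℕ} (K D : Matrix (Fin d) (Fin d) ℝ) (s : ℝ) : Matrix (Fin d) (Fin d) ℝ :=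
  Matrix.of fun i j => ∫ u in (0 : ℝ)..s,
    (NormedSpace.exp (-(u • K)) * (D * Dᵀ) * (NormedSpace.exp (-(u • K)))ᵀ) i j

/-- The transition law over a time span `s` of the Ornstein–Uhlenbeck process
`dX = -K (X - c) dt + D dW`, that is, the law of
`X(s) = c + e^{-sK} (x - c) + ∫₀ˢ e^{-(s-u)K} D dW(u)`. -/
def ouLaw {d : ℕ} (c : EuclideanSpace ℝ (Fin d)) (K D : Matrix (Fin d) (Fin d) ℝ) (s : ℝ)
    (x : EuclideanSpace ℝ (Fin d)) : Measure (EuclideanSpace ℝ (Fin d)) :=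
  multivariateGaussian
    (c + WithLp.toLp 2 (NormedSpace.exp (-(s • K)) *ᵥ WithLp.ofLp (x - c))) (ouCov K D s)

/-- `Q` is a stationary distribution of the Ornstein–Uhlenbeck process
`dX = -K (X - c) dt + D dW`: a probability measure that every transition law leaves invariant. -/
def IsOUStationary {d : ℕ} (c : EuclideanSpace ℝ (Fin d)) (K D : Matrix (Fin d) (Fin d) ℝ)
    (Q : Measure (EuclideanSpace ℝ (Fin d))) : Prop :=
  IsProbabilityMeasure Q ∧
    ∀ s : ℝ, 0 ≤ s → ∀ U : Set (EuclideanSpace ℝ (Fin d)), MeasurableSet U →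
      ∫⁻ x, ouLaw c K D s x U ∂Q = Q U

/-- The covariance matrix of a law on `ℝᵈ`. -/
def covMat {d : ℕ} (Q : Measure (EuclideanSpace ℝ (Fin d))) : Matrix (Fin d) (Fin d) ℝ :=
  Matrix.of fun i j => cov[fun θ => θ i, fun θ => θ j; Q]

/-! ### Federated SGD

In the local model of client `i` around the minimum `θ*`, the stochastic gradient at `θ` for the
batch size `s` is `A i (θ - θ*) + s^{-1/2} B i ξ` with `ξ` standard Gaussian: its mean is
`A i (θ - θ*)`, with `A i` positive semidefinite, and its covariance is `s⁻¹ C i`, `C i = B i (B i)ᵀ`.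
-/

/-- The average `(1/n) ∑ i, X i` over the clients. -/
def clientMean {n d : ℕ} (X : Fin n → Matrix (Fin d) (Fin d) ℝ) : Matrix (Fin d) (Fin d) ℝ :=
  (n : ℝ)⁻¹ • ∑ i, X i

/-- The matrix `C̄ = B̄ B̄ᵀ`, where `B̄` is the average of the noise factors `B i`. -/
def meanNoise {n d : ℕ} (B : Fin n → Matrix (Fin d) (Fin d) ℝ) : Matrix (Fin d) (Fin d) ℝ :=
  clientMean B * (clientMean B)ᵀ

/-- `Q` is a stationary distribution of federated SGD with `T` rounds, learning rate `η` and local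
batch size `s`, that is, of the Ornstein–Uhlenbeck process
`θ(t) = θ* + e^{-T Ā t} (θ(0) - θ*) + T √(η/s) ∫₀ᵗ e^{-T Ā (t-t')} B̄ dW(t')` which models it. -/
def IsFedStationary {n d : ℕ} (θs : EuclideanSpace ℝ (Fin d))
    (A B : Fin n → Matrix (Fin d) (Fin d) ℝ) (T : ℕ) (η s : ℝ)
    (Q : Measure (EuclideanSpace ℝ (Fin d))) : Prop :=
  IsOUStationary θs ((T : ℝ) • clientMean A) ((T * √(η / s)) • clientMean B) Q

end FedPAC

end

namespace FedPAC

open Filter Topology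
open scoped NNReal

/-! ### Stationary laws of Ornstein–Uhlenbeck processes -/

/-! Covariance. Over a time span `s` a stationary law `Q` is reproduced as the law of `c + e^{-sK}(X
- c)`, with `X ∼ Q`, plus an independent centered Gaussian vector of covariance `ouCov K D s`. A
positive definite drift makes the first part forget `X` as `s → ∞`, so `Q` is Gaussian with mean
`c`, and its covariance `V`, the limit of `ouCov`, solves the Lyapunov equation `K V + V K = D Dᵀ`
(`IsOUStationary.exists_lyapunov`). When `V` commutes with `Ā` the two terms on the left agree, and
one solves for `V`.

Generalization. This is a PAC-Bayes argument with the prior `N(θ*, I)`, which does not depend on the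
sample. Let `N = nm` and let `Δ(θ)` be the gap of the risks at `θ`. It averages `N` independent
centered variables with values in intervals of length 1, so it is sub-Gaussian with parameter
`1/(4N)`, and `exp((2N-1)Δ²)` has mean at most `√(2N)` (`lintegral_exp_sq_meanGap_le`). Fubini and
Markov give an event of probability at least `1 - δ` on which the prior mean of this exponential is
at most `√(2N)/δ`. The event is chosen before any posterior, hence the uniformity. On it, the
Donsker–Varadhan inequality (`exp_integral_sub_kl_le`) and Jensen give `(2N-1)(∫ Δ dQ)² ≤ KL +
log(√(2N)/δ)`, where `KL = (tr V - d - log det V)/2` for `Q = N(θ*, V)`. -/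

lemma multivariateGaussian_eq_map_const_add {d : ℕ} (c : EuclideanSpace ℝ (Fin d))
    (S : Matrix (Fin d) (Fin d) ℝ) :
    multivariateGaussian c S = (multivariateGaussian 0 S).map (c + ·) := by
  rw [multivariateGaussian, multivariateGaussian, Measure.map_map (by fun_prop) (by fun_prop)]
  congr 1
  ext x
  simp

/-- The drift of an Ornstein–Uhlenbeck process over a time span, started from `x`. -/
noncomputable def ouMean {d : ℕ} (c : EuclideanSpace ℝ (Fin d)) (K : Matrix (Fin d) (Fin d) ℝ)
    (s : ℝ) (x : EuclideanSpace ℝ (Fin d)) : EuclideanSpace ℝ (Fin d) :=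
  c + WithLp.toLp 2 (NormedSpace.exp (-(s • K)) *ᵥ WithLp.ofLp (x - c))

lemma measurable_ouMean {d : ℕ} (c : EuclideanSpace ℝ (Fin d)) (K : Matrix (Fin d) (Fin d) ℝ)
    (s : ℝ) : Measurable (ouMean c K s) := by
  have : ouMean c K s = fun x => c + Matrix.toEuclideanCLM (𝕜 := ℝ)
      (NormedSpace.exp (-(s • K))) (x - c) := by
    ext x i
    simp [ouMean, Matrix.ofLp_toEuclideanCLM, Matrix.mulVec_sub]
  rw [this]
  fun_prop

/-- The Gaussian noise of a transition does not depend on the starting point, so averaging the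
transition laws over `Q` is a convolution, and characteristic functions factor. -/
lemma IsOUStationary.eq_conv {d : ℕ} {c : EuclideanSpace ℝ (Fin d)}
    {K D : Matrix (Fin d) (Fin d) ℝ} {Q : Measure (EuclideanSpace ℝ (Fin d))}
    (hQ : IsOUStationary c K D Q) {s : ℝ} (hs : 0 ≤ s) :
    Q = (Q.map (ouMean c K s)).conv (multivariateGaussian 0 (ouCov K D s)) := by
  have := hQ.1
  ext U hU
  rw [← hQ.2 s hs U hU, Measure.conv, Measure.map_apply (by fun_prop) hU,
    Measure.prod_apply (hU.preimage (by fun_prop)),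
    lintegral_map (measurable_measure_prodMk_left (hU.preimage (by fun_prop)))
      (measurable_ouMean c K s)]
  refine lintegral_congr fun x => ?_
  rw [ouLaw, multivariateGaussian_eq_map_const_add, Measure.map_apply (by fun_prop) hU]
  rfl

/-- The characteristic function of `Q` is constant in `s`, so it equals the limit of its
factorization as `s → ∞`. The integrands have modulus 1, so dominated convergence needs no moments
of `Q`. -/
lemma IsOUStationary.eq_multivariateGaussian {d : ℕ} {c : EuclideanSpace ℝ (Fin d)}
    {K D S : Matrix (Fin d) (Fin d) ℝ} {Q : Measure (EuclideanSpace ℝ (Fin d))}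
    (hQ : IsOUStationary c K D Q) (hpos : ∀ s, 0 ≤ s → (ouCov K D s).PosSemidef)
    (hS : S.PosSemidef) (hcov : Tendsto (ouCov K D) atTop (𝓝 S))
    (hexp : Tendsto (fun s : ℝ => NormedSpace.exp (-(s • K))) atTop (𝓝 0)) :
    Q = multivariateGaussian c S := by
  have := hQ.1
  refine Measure.ext_of_charFun (funext fun t => ?_)
  have hchar : ∀ s, 0 ≤ s → charFun Q t =
      (∫ x, Complex.exp (inner ℝ (ouMean c K s x) t * Complex.I) ∂Q) *
        Complex.exp (-((t ⬝ᵥ ouCov K D s *ᵥ t : ℝ) : ℂ) / 2) := by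
    intro s hs
    have h1 : IsProbabilityMeasure (Q.map (ouMean c K s)) :=
      Measure.isProbabilityMeasure_map (measurable_ouMean c K s).aemeasurable
    conv_lhs => rw [hQ.eq_conv hs]
    rw [charFun_conv, charFun_multivariateGaussian (hpos s hs), charFun_apply,
      integral_map (measurable_ouMean c K s).aemeasurable (by fun_prop)]
    simp [neg_div]
  have hlim1 : Tendsto (fun s : ℝ =>
      ∫ x, Complex.exp (inner ℝ (ouMean c K s x) t * Complex.I) ∂Q) atTop
      (𝓝 (∫ _, Complex.exp (inner ℝ c t * Complex.I) ∂Q)) := by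
    refine tendsto_integral_filter_of_dominated_convergence (fun _ => 1)
      (Eventually.of_forall fun s => ?_) (Eventually.of_forall fun s => ?_)
      (integrable_const _) (Eventually.of_forall fun x => ?_)
    · have := measurable_ouMean c K s
      exact Measurable.aestronglyMeasurable (by fun_prop)
    · exact Eventually.of_forall fun x => by rw [Complex.norm_exp_ofReal_mul_I]
    · have hm : Tendsto (fun s => ouMean c K s x) atTop (𝓝 c) := by
        have h0 : Tendsto (fun s : ℝ => c + WithLp.toLp 2
            (NormedSpace.exp (-(s • K)) *ᵥ WithLp.ofLp (x - c))) atTop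
            (𝓝 (c + WithLp.toLp 2 ((0 : Matrix (Fin d) (Fin d) ℝ) *ᵥ WithLp.ofLp (x - c)))) := by
          refine tendsto_const_nhds.add
            (((PiLp.continuous_toLp 2 _).tendsto _).comp ?_)
          exact ((Continuous.matrix_mulVec continuous_id continuous_const).tendsto 0).comp hexp
        rw [Matrix.zero_mulVec, WithLp.toLp_zero, add_zero] at h0
        exact h0
      have hcont : Continuous fun y : EuclideanSpace ℝ (Fin d) =>
          Complex.exp (inner ℝ y t * Complex.I) := by fun_prop
      exact (hcont.tendsto c).comp hm
  have hlim2 : Tendsto (fun s : ℝ => Complex.exp (-((t ⬝ᵥ ouCov K D s *ᵥ t : ℝ) : ℂ) / 2)) atTop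
      (𝓝 (Complex.exp (-((t ⬝ᵥ S *ᵥ t : ℝ) : ℂ) / 2))) := by
    have hcont : Continuous fun X : Matrix (Fin d) (Fin d) ℝ =>
        Complex.exp (-((WithLp.ofLp t ⬝ᵥ X *ᵥ WithLp.ofLp t : ℝ) : ℂ) / 2) := by
      have : Continuous fun X : Matrix (Fin d) (Fin d) ℝ => WithLp.ofLp t ⬝ᵥ X *ᵥ WithLp.ofLp t :=
        continuous_const.dotProduct (continuous_id.matrix_mulVec continuous_const)
      fun_prop
    exact (hcont.tendsto S).comp hcov
  have hlim := hlim1.mul hlim2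
  have heq : Tendsto (fun _ : ℝ => charFun Q t) atTop (𝓝 (charFun Q t)) := tendsto_const_nhds
  rw [tendsto_nhds_unique (heq.congr' (by
    filter_upwards [eventually_ge_atTop 0] with s hs using hchar s hs)) hlim,
    charFun_multivariateGaussian hS, integral_const]
  simp only [probReal_univ, one_smul]
  rw [← Complex.exp_add, real_inner_comm]
  congr 1
  ring

/-! ### Diagonalization of the drift -/

lemma PosDef.exists_diagonalization {d : ℕ} {A : Matrix (Fin d) (Fin d) ℝ} (hA : A.PosDef) :
    ∃ (U : Matrix (Fin d) (Fin d) ℝ) (l : Fin d → ℝ), Uᵀ * U = 1 ∧ U * Uᵀ = 1 ∧ (∀ i, 0 < l i) ∧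
      A = U * Matrix.diagonal l * Uᵀ := by
  refine ⟨hA.1.eigenvectorUnitary, hA.1.eigenvalues, ?_, ?_, hA.eigenvalues_pos, ?_⟩
  · exact Unitary.coe_star_mul_self hA.1.eigenvectorUnitary
  · exact Unitary.coe_mul_star_self hA.1.eigenvectorUnitary
  · conv_lhs => rw [hA.1.spectral_theorem, Unitary.conjStarAlgAut_apply]
    rfl

lemma exp_neg_smul_diagonalization {d : ℕ} {U : Matrix (Fin d) (Fin d) ℝ} (l : Fin d → ℝ)
    (h2 : U * Uᵀ = 1) (s : ℝ) :
    NormedSpace.exp (-(s • (U * Matrix.diagonal l * Uᵀ))) =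
      U * Matrix.diagonal (fun i => Real.exp (-(s * l i))) * Uᵀ := by
  have hinv : U⁻¹ = Uᵀ := Matrix.inv_eq_right_inv h2
  have hu : IsUnit U := by
    rw [Matrix.isUnit_iff_isUnit_det]
    exact Matrix.isUnit_det_of_right_inverse h2
  have : -(s • (U * Matrix.diagonal l * Uᵀ)) =
      U * Matrix.diagonal (fun i => -(s * l i)) * U⁻¹ := by
    rw [hinv, show Matrix.diagonal (fun i => -(s * l i)) = -(s • Matrix.diagonal l) by
      rw [← Matrix.diagonal_smul, ← Matrix.diagonal_neg]; rfl]
    simp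
  rw [this, Matrix.exp_conj _ _ hu, Matrix.exp_diagonal, hinv]
  congr 3
  ext i
  rw [Pi.coe_exp, Real.exp_eq_exp_ℝ]

lemma tendsto_exp_neg_mul_atTop {a : ℝ} (ha : 0 < a) :
    Tendsto (fun s : ℝ => Real.exp (-(s * a))) atTop (𝓝 0) :=
  Real.tendsto_exp_neg_atTop_nhds_zero.comp (tendsto_id.atTop_mul_const ha)

lemma tendsto_exp_neg_smul_diagonalization {d : ℕ} {U : Matrix (Fin d) (Fin d) ℝ} {l : Fin d → ℝ}
    (h2 : U * Uᵀ = 1) (hl : ∀ i, 0 < l i) :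
    Tendsto (fun s : ℝ => NormedSpace.exp (-(s • (U * Matrix.diagonal l * Uᵀ)))) atTop (𝓝 0) := by
  simp_rw [exp_neg_smul_diagonalization l h2]
  have h : Tendsto (fun s : ℝ => fun i => Real.exp (-(s * l i))) atTop (𝓝 (0 : Fin d → ℝ)) :=
    tendsto_pi_nhds.2 fun i => tendsto_exp_neg_mul_atTop (hl i)
  have hc : Continuous fun v : Fin d → ℝ => U * Matrix.diagonal v * Uᵀ := by fun_prop
  have h0 := (hc.tendsto 0).comp h
  rw [Pi.zero_def, Matrix.diagonal_zero, Matrix.mul_zero, Matrix.zero_mul] at h0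
  exact h0

lemma integral_exp_neg_mul {a : ℝ} (ha : 0 < a) (s : ℝ) :
    ∫ u in (0 : ℝ)..s, Real.exp (-(u * a)) = (1 - Real.exp (-(s * a))) / a := by
  have h : ∀ u ∈ Set.uIcc 0 s, HasDerivAt (fun u => -Real.exp (-(u * a)) / a)
      (Real.exp (-(u * a))) u := by
    intro u _
    have := ((((hasDerivAt_id u).mul_const a).neg.exp).neg).div_const a
    refine this.congr_deriv ?_
    simp [ha.ne']
  rw [intervalIntegral.integral_eq_sub_of_hasDerivAt h (by
    apply Continuous.intervalIntegrable; fun_prop)]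
  simp only [zero_mul, neg_zero, Real.exp_zero]
  ring

/-- The solution of the Lyapunov equation `K S + S K = N` for
`K = U diag(l) Uᵀ` and `N = U X Uᵀ`. -/
noncomputable def lyapunovSol {d : ℕ} (U X : Matrix (Fin d) (Fin d) ℝ) (l : Fin d → ℝ) :
    Matrix (Fin d) (Fin d) ℝ :=
  U * Matrix.of (fun i j => X i j / (l i + l j)) * Uᵀ

/-- In an eigenbasis of the drift the entries decouple: the integrand is multiplied entrywise by
`e^{-u(l i + l j)}`, which integrates explicitly. -/
lemma ouCov_diagonalization {d : ℕ} {U : Matrix (Fin d) (Fin d) ℝ} {l : Fin d → ℝ}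
    (D : Matrix (Fin d) (Fin d) ℝ) (h2 : U * Uᵀ = 1) (hl : ∀ i, 0 < l i) (s : ℝ) :
    ouCov (U * Matrix.diagonal l * Uᵀ) D s =
      U * Matrix.of (fun i j => (Uᵀ * (D * Dᵀ) * U) i j *
        ((1 - Real.exp (-(s * (l i + l j)))) / (l i + l j))) * Uᵀ := by
  set X := Uᵀ * (D * Dᵀ) * U with hX
  have key : ∀ u : ℝ, NormedSpace.exp (-(u • (U * Matrix.diagonal l * Uᵀ))) * (D * Dᵀ) *
      (NormedSpace.exp (-(u • (U * Matrix.diagonal l * Uᵀ))))ᵀ =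
      U * Matrix.of (fun i j => X i j * Real.exp (-(u * (l i + l j)))) * Uᵀ := by
    intro u
    have : Matrix.of (fun i j => X i j * Real.exp (-(u * (l i + l j)))) =
        Matrix.diagonal (fun i => Real.exp (-(u * l i))) * X *
          Matrix.diagonal (fun i => Real.exp (-(u * l i))) := by
      ext i j
      rw [Matrix.mul_diagonal, Matrix.diagonal_mul, Matrix.of_apply, mul_add, neg_add,
        Real.exp_add]
      ring
    rw [this, exp_neg_smul_diagonalization l h2, hX]
    simp only [Matrix.transpose_mul, Matrix.transpose_transpose, Matrix.diagonal_transpose,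
      Matrix.mul_assoc]
  ext i j
  simp only [ouCov, Matrix.of_apply, key]
  simp only [Matrix.mul_apply, Matrix.of_apply, Finset.sum_mul]
  rw [intervalIntegral.integral_finsetSum (fun b _ => by
    apply Continuous.intervalIntegrable; fun_prop)]
  refine Finset.sum_congr rfl fun b _ => ?_
  rw [intervalIntegral.integral_finsetSum (fun b _ => by
    apply Continuous.intervalIntegrable; fun_prop)]
  refine Finset.sum_congr rfl fun a _ => ?_
  rw [← integral_exp_neg_mul (add_pos (hl a) (hl b)), intervalIntegral.integral_mul_const,
    intervalIntegral.integral_const_mul, intervalIntegral.integral_const_mul]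

lemma tendsto_ouCov {d : ℕ} {U : Matrix (Fin d) (Fin d) ℝ} {l : Fin d → ℝ}
    (D : Matrix (Fin d) (Fin d) ℝ) (h2 : U * Uᵀ = 1) (hl : ∀ i, 0 < l i) :
    Tendsto (ouCov (U * Matrix.diagonal l * Uᵀ) D) atTop
      (𝓝 (lyapunovSol U (Uᵀ * (D * Dᵀ) * U) l)) := by
  have heq := funext (ouCov_diagonalization D h2 hl)
  rw [heq, lyapunovSol]
  have hc : Continuous fun Y : Matrix (Fin d) (Fin d) ℝ => U * Y * Uᵀ := by fun_prop
  refine (hc.tendsto _).comp ?_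
  refine tendsto_pi_nhds.2 fun i => tendsto_pi_nhds.2 fun j => ?_
  have h := ((tendsto_exp_neg_mul_atTop (add_pos (hl i) (hl j))).const_sub 1).div_const
    (l i + l j) |>.const_mul ((Uᵀ * (D * Dᵀ) * U) i j)
  simpa [div_eq_mul_inv] using h

/-- In the eigenbasis the equation reads `(l i + l j) Y i j = X i j`. -/
lemma lyapunovSol_spec {d : ℕ} {U : Matrix (Fin d) (Fin d) ℝ} {l : Fin d → ℝ}
    (N : Matrix (Fin d) (Fin d) ℝ) (h1 : Uᵀ * U = 1) (h2 : U * Uᵀ = 1) (hl : ∀ i, 0 < l i) :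
    (U * Matrix.diagonal l * Uᵀ) * lyapunovSol U (Uᵀ * N * U) l +
      lyapunovSol U (Uᵀ * N * U) l * (U * Matrix.diagonal l * Uᵀ) = N := by
  set X := Uᵀ * N * U with hX
  set Y := Matrix.of (fun i j => X i j / (l i + l j)) with hY
  have hXY : Matrix.diagonal l * Y + Y * Matrix.diagonal l = X := by
    ext i j
    have := (add_pos (hl i) (hl j)).ne'
    rw [Matrix.add_apply, Matrix.mul_diagonal, Matrix.diagonal_mul, hY, Matrix.of_apply]
    field_simp
  have e1 : (U * Matrix.diagonal l * Uᵀ) * (U * Y * Uᵀ) = U * (Matrix.diagonal l * Y) * Uᵀ := by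
    calc _ = U * Matrix.diagonal l * (Uᵀ * U) * Y * Uᵀ := by simp only [Matrix.mul_assoc]
      _ = _ := by rw [h1]; simp only [Matrix.mul_assoc, Matrix.one_mul]
  have e2 : (U * Y * Uᵀ) * (U * Matrix.diagonal l * Uᵀ) = U * (Y * Matrix.diagonal l) * Uᵀ := by
    calc _ = U * Y * (Uᵀ * U) * Matrix.diagonal l * Uᵀ := by simp only [Matrix.mul_assoc]
      _ = _ := by rw [h1]; simp only [Matrix.mul_assoc, Matrix.one_mul]
  rw [lyapunovSol, e1, e2, ← Matrix.add_mul, ← Matrix.mul_add, hXY, hX]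
  calc _ = (U * Uᵀ) * N * (U * Uᵀ) := by simp only [Matrix.mul_assoc]
    _ = N := by simp [h2]

/-- The integrand has the form `E Eᵀ` with `E = e^{-uK} D`, and quadratic forms commute with the
integral. Without positive semidefiniteness the characteristic function formula for
`multivariateGaussian` is not available. -/
lemma ouCov_posSemidef {d : ℕ} (K D : Matrix (Fin d) (Fin d) ℝ)
    (hK : Continuous fun u : ℝ => NormedSpace.exp (-(u • K))) {s : ℝ} (hs : 0 ≤ s) :
    (ouCov K D s).PosSemidef := by
  set G : ℝ → Matrix (Fin d) (Fin d) ℝ := fun u =>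
    NormedSpace.exp (-(u • K)) * (D * Dᵀ) * (NormedSpace.exp (-(u • K)))ᵀ with hG
  have hGc : Continuous G := by fun_prop
  have hGpos : ∀ u, (G u).PosSemidef := by
    intro u
    have := Matrix.posSemidef_self_mul_conjTranspose (NormedSpace.exp (-(u • K)) * D)
    rw [Matrix.conjTranspose_mul] at this
    simpa [hG, Matrix.mul_assoc, Matrix.conjTranspose_eq_transpose_of_trivial] using this
  have hGij : ∀ i j, Continuous fun u => G u i j := fun i j => by
    exact (continuous_apply j).comp ((continuous_apply i).comp hGc)
  refine Matrix.PosSemidef.of_dotProduct_mulVec_nonneg ?_ fun x => ?_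
  · ext i j
    simp only [ouCov, Matrix.conjTranspose_apply, Matrix.of_apply, star_trivial]
    refine intervalIntegral.integral_congr fun u _ => ?_
    simpa using (hGpos u).1.apply i j
  · have : star x ⬝ᵥ ouCov K D s *ᵥ x = ∫ u in (0 : ℝ)..s, x ⬝ᵥ G u *ᵥ x := by
      simp only [dotProduct, Matrix.mulVec, star_trivial, ouCov, Matrix.of_apply]
      rw [intervalIntegral.integral_finsetSum (fun b _ => by
        apply Continuous.intervalIntegrable; fun_prop)]
      refine Finset.sum_congr rfl fun b _ => ?_
      rw [intervalIntegral.integral_const_mul, intervalIntegral.integral_finsetSum (fun b _ => by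
        apply Continuous.intervalIntegrable; fun_prop)]
      congr 1
      refine Finset.sum_congr rfl fun a _ => ?_
      rw [intervalIntegral.integral_mul_const]
    rw [this]
    exact intervalIntegral.integral_nonneg hs fun u _ => by
      simpa using (hGpos u).dotProduct_mulVec_nonneg x

/-- A stationary law of an Ornstein–Uhlenbeck process with positive definite drift is Gaussian, and
its covariance matrix solves the Lyapunov equation. -/
theorem IsOUStationary.exists_lyapunov {d : ℕ} {c : EuclideanSpace ℝ (Fin d)}
    {K D : Matrix (Fin d) (Fin d) ℝ} {Q : Measure (EuclideanSpace ℝ (Fin d))}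
    (hQ : IsOUStationary c K D Q) (hK : K.PosDef) :
    ∃ S : Matrix (Fin d) (Fin d) ℝ, S.PosSemidef ∧ Q = multivariateGaussian c S ∧
      K * S + S * K = D * Dᵀ := by
  obtain ⟨U, l, h1, h2, hl, rfl⟩ := PosDef.exists_diagonalization hK
  have hcont : Continuous fun u : ℝ => NormedSpace.exp (-(u • (U * Matrix.diagonal l * Uᵀ))) := by
    simp_rw [exp_neg_smul_diagonalization l h2]
    fun_prop
  have hpos : ∀ s, 0 ≤ s → (ouCov (U * Matrix.diagonal l * Uᵀ) D s).PosSemidef :=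
    fun s hs => ouCov_posSemidef _ D hcont hs
  have hlim := tendsto_ouCov D h2 hl
  have hS : (lyapunovSol U (Uᵀ * (D * Dᵀ) * U) l).PosSemidef := by
    refine Matrix.PosSemidef.of_dotProduct_mulVec_nonneg ?_ fun x => ?_
    · have hc : Continuous fun X : Matrix (Fin d) (Fin d) ℝ => Xᴴ := by fun_prop
      refine tendsto_nhds_unique (((hc.tendsto _).comp hlim).congr' ?_) hlim
      filter_upwards [eventually_ge_atTop 0] with s hs using (hpos s hs).1
    · have hc : Continuous fun X : Matrix (Fin d) (Fin d) ℝ => star x ⬝ᵥ X *ᵥ x :=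
        continuous_const.dotProduct (continuous_id.matrix_mulVec continuous_const)
      refine ge_of_tendsto ((hc.tendsto _).comp hlim) ?_
      filter_upwards [eventually_ge_atTop 0] with s hs using (hpos s hs).dotProduct_mulVec_nonneg x
  exact ⟨_, hS, hQ.eq_multivariateGaussian hpos hS hlim
    (tendsto_exp_neg_smul_diagonalization h2 hl), lyapunovSol_spec _ h1 h2 hl⟩

/-! ### Stationary covariance of federated SGD -/

lemma covMat_multivariateGaussian {d : ℕ} (c : EuclideanSpace ℝ (Fin d))
    {S : Matrix (Fin d) (Fin d) ℝ} (hS : S.PosSemidef) : covMat (multivariateGaussian c S) = S := by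
  ext i j
  exact covariance_eval_multivariateGaussian hS i j

lemma clientMean_posSemidef {n d : ℕ} {A : Fin n → Matrix (Fin d) (Fin d) ℝ}
    (hA : ∀ i, (A i).PosSemidef) : (clientMean A).PosSemidef := by
  refine Matrix.PosSemidef.smul ?_ (by positivity)
  exact Finset.sum_induction A Matrix.PosSemidef (fun _ _ => Matrix.PosSemidef.add)
    Matrix.PosSemidef.zero fun i _ => hA i

/-- A stationary law of federated SGD whose covariance matrix commutes with `Ā` is Gaussian with the
covariance matrix `(T η / (2 s)) C̄ Ā⁻¹`. -/
theorem IsFedStationary.eq_multivariateGaussian {n d : ℕ} {θs : EuclideanSpace ℝ (Fin d)}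
    {A B : Fin n → Matrix (Fin d) (Fin d) ℝ} {T : ℕ} (hT : 0 < T) {η s : ℝ} (hη : 0 < η)
    (hs : 0 < s) {Q : Measure (EuclideanSpace ℝ (Fin d))} (hA : ∀ i, (A i).PosSemidef)
    (hdet : IsUnit (clientMean A).det) (hQ : IsFedStationary θs A B T η s Q)
    (hcomm : clientMean A * covMat Q = covMat Q * clientMean A) :
    (covMat Q).PosSemidef ∧ Q = multivariateGaussian θs (covMat Q) ∧
      covMat Q = (T * η / (2 * s)) • (meanNoise B * (clientMean A)⁻¹) := by
  have hT' : (0 : ℝ) < T := by exact_mod_cast hT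
  have hpd : (clientMean A).PosDef :=
    (clientMean_posSemidef hA).posDef_iff_isUnit.2 ((Matrix.isUnit_iff_isUnit_det _).2 hdet)
  obtain ⟨S, hS, hQS, hL⟩ := IsOUStationary.exists_lyapunov hQ (hpd.smul hT')
  have hcov : covMat Q = S := by rw [hQS, covMat_multivariateGaussian θs hS]
  rw [hcov] at hcomm ⊢
  refine ⟨hS, hQS, ?_⟩
  have hsq : √(η / s) ^ 2 = η / s := Real.sq_sqrt (by positivity)
  -- Commutation merges the two Lyapunov terms into `2T S Ā`. The right-hand side carries `T² η/s`,
  -- so one factor `T` survives the division.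
  have h2 : (2 * T : ℝ) • (S * clientMean A) = (T ^ 2 * (η / s)) • meanNoise B := by
    have h3 : (2 * T : ℝ) • (S * clientMean A) =
        (T : ℝ) • clientMean A * S + S * (T : ℝ) • clientMean A := by
      rw [Matrix.smul_mul, Matrix.mul_smul, hcomm, ← add_smul, two_mul]
    rw [h3, hL, meanNoise, Matrix.transpose_smul, Matrix.smul_mul, Matrix.mul_smul, smul_smul]
    congr 1
    calc T * √(η / s) * (T * √(η / s)) = T ^ 2 * √(η / s) ^ 2 := by ring
      _ = _ := by rw [hsq]
  have h4 : S * clientMean A = (T * η / (2 * s)) • meanNoise B := by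
    have := congrArg (fun X => (2 * T : ℝ)⁻¹ • X) h2
    simp only [smul_smul] at this
    rw [inv_mul_cancel₀ (by positivity), one_smul] at this
    rw [this]
    congr 1
    field_simp
  rw [← Matrix.smul_mul, ← h4, Matrix.mul_nonsing_inv_cancel_right _ _ hdet]

/-! ### Relative entropy of Gaussian laws -/

/-- On a box the indicator of the product splits over the coordinates, and independence factors the
integral. This reduces the relative entropy to dimension one. -/
lemma pi_withDensity {ι : Type*} [Fintype ι] {X : ι → Type*} [∀ i, MeasurableSpace (X i)]
    (μ : ∀ i, Measure (X i)) [∀ i, IsProbabilityMeasure (μ i)] {f : ∀ i, X i → ℝ≥0∞}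
    (hf : ∀ i, Measurable (f i)) [∀ i, SigmaFinite ((μ i).withDensity (f i))] :
    Measure.pi (fun i => (μ i).withDensity (f i)) =
      (Measure.pi μ).withDensity fun x => ∏ i, f i (x i) := by
  refine Measure.pi_eq fun s hs => ?_
  have hg : ∀ i, Measurable ((s i).indicator (f i)) := fun i => (hf i).indicator (hs i)
  rw [withDensity_apply _ (MeasurableSet.univ_pi hs),
    ← lintegral_indicator (MeasurableSet.univ_pi hs)]
  have : (Set.univ.pi s).indicator (fun x => ∏ i, f i (x i)) =
      fun x => ∏ i, (s i).indicator (f i) (x i) := by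
    ext x
    by_cases hx : x ∈ Set.univ.pi s
    · rw [Set.indicator_of_mem hx]
      exact Finset.prod_congr rfl fun i _ => (Set.indicator_of_mem (hx i trivial) _).symm
    · rw [Set.indicator_of_notMem hx]
      simp only [Set.mem_pi, Set.mem_univ, true_imp_iff, not_forall] at hx
      obtain ⟨i, hi⟩ := hx
      exact (Finset.prod_eq_zero (Finset.mem_univ i) (Set.indicator_of_notMem hi _)).symm
  rw [this, lintegral_prod_eq_prod_lintegral_of_indepFun Finset.univ
    (fun i (x : ∀ i, X i) => (s i).indicator (f i) (x i))
    (iIndepFun_pi fun i => (hg i).aemeasurable)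
    (fun i => (hg i).comp (measurable_pi_apply i))]
  refine Finset.prod_congr rfl fun i _ => ?_
  rw [withDensity_apply _ (hs i), ← lintegral_indicator (hs i),
    ← (measurePreserving_eval μ i).lintegral_comp (hg i)]

/-- The logarithmic density of the standard Gaussian law with respect to a centered Gaussian law
of variance `v`. -/
noncomputable def logDensity (v y : ℝ) : ℝ := Real.log v / 2 + y ^ 2 / (2 * v) - y ^ 2 / 2

lemma gaussianReal_one_eq_withDensity {v : ℝ≥0} (hv : v ≠ 0) :
    gaussianReal 0 1 =
      (gaussianReal 0 v).withDensity fun y => ENNReal.ofReal (Real.exp (logDensity v y)) := by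
  have hv' : (0 : ℝ) < v := by positivity
  rw [gaussianReal_of_var_ne_zero 0 hv, gaussianReal_of_var_ne_zero 0 one_ne_zero,
    ← withDensity_mul _ (measurable_gaussianPDF 0 v) (by unfold logDensity; fun_prop)]
  congr 1
  ext y
  rw [Pi.mul_apply, gaussianPDF, gaussianPDF, ← ENNReal.ofReal_mul (gaussianPDFReal_nonneg _ _ _)]
  congr 1
  have hsq : Real.exp (Real.log v / 2) = √v := by
    rw [Real.sqrt_eq_rpow, Real.rpow_def_of_pos hv']
    congr 1
    ring
  rw [gaussianPDFReal, gaussianPDFReal, logDensity, add_sub_assoc, Real.exp_add, hsq,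
    Real.sqrt_mul (by positivity) (v : ℝ)]
  have h1 : √(v : ℝ) ≠ 0 := (Real.sqrt_pos.2 hv').ne'
  have : ∀ a b : ℝ, (√(2 * Real.pi) * √v)⁻¹ * a * (√v * b) = (√(2 * Real.pi))⁻¹ * (a * b) := by
    intro a b
    field_simp
  rw [this, ← Real.exp_add, NNReal.coe_one, mul_one]
  congr 2
  ring

lemma integrable_sq_gaussianReal (v : ℝ≥0) : Integrable (fun y => y ^ 2) (gaussianReal 0 v) :=
  (memLp_id_gaussianReal 2).integrable_sq

lemma integral_sq_gaussianReal (v : ℝ≥0) : ∫ y, y ^ 2 ∂gaussianReal 0 v = v := by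
  have h := variance_eq_sub (μ := gaussianReal 0 v) (X := id) (memLp_id_gaussianReal 2)
  rw [variance_id_gaussianReal] at h
  simpa using h.symm

lemma integrable_logDensity (v : ℝ≥0) : Integrable (logDensity v) (gaussianReal 0 v) := by
  have := integrable_sq_gaussianReal v
  exact ((integrable_const _).add (this.div_const _)).sub (this.div_const _)

/-- This value is minus the relative entropy of `N(0, v)` with respect to `N(0, 1)`. -/
lemma integral_logDensity {v : ℝ≥0} (hv : v ≠ 0) :
    ∫ y, logDensity v y ∂gaussianReal 0 v = (Real.log v + 1 - v) / 2 := by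
  have := integrable_sq_gaussianReal v
  have hv' : (0 : ℝ) < v := by positivity
  have h1 : Integrable (fun y => Real.log v / 2 + y ^ 2 / (2 * (v : ℝ))) (gaussianReal 0 v) :=
    (integrable_const _).add (this.div_const _)
  simp only [logDensity]
  rw [integral_sub h1 (this.div_const _),
    integral_add (integrable_const _) (this.div_const _), integral_const, integral_div,
    integral_div, integral_sq_gaussianReal, probReal_univ, one_smul]
  field_simp

/-- A Gaussian law with the covariance matrix `U diag(l) Uᵀ` is the image of a product of centered
Gaussian laws under an affine map. -/
lemma multivariateGaussian_eq_map_pi {d : ℕ} (c : EuclideanSpace ℝ (Fin d))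
    {U : Matrix (Fin d) (Fin d) ℝ} {S : Matrix (Fin d) (Fin d) ℝ} (l : Fin d → ℝ≥0)
    (hS : S = U * Matrix.diagonal (fun i => (l i : ℝ)) * Uᵀ) (hpos : S.PosSemidef) :
    multivariateGaussian c S = (Measure.pi fun i => gaussianReal 0 (l i)).map
      fun y => c + Matrix.toEuclideanCLM (𝕜 := ℝ) U (WithLp.toLp 2 y) := by
  have hm : Measurable fun y : Fin d → ℝ =>
      c + Matrix.toEuclideanCLM (𝕜 := ℝ) U (WithLp.toLp 2 y) := by fun_prop
  have : IsProbabilityMeasure ((Measure.pi fun i => gaussianReal 0 (l i)).map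
      fun y => c + Matrix.toEuclideanCLM (𝕜 := ℝ) U (WithLp.toLp 2 y)) :=
    Measure.isProbabilityMeasure_map hm.aemeasurable
  refine Measure.ext_of_charFun (funext fun t => ?_)
  rw [charFun_multivariateGaussian hpos, charFun_apply, integral_map hm.aemeasurable (by fun_prop)]
  have hinner : ∀ y : Fin d → ℝ, inner ℝ
      (c + Matrix.toEuclideanCLM (𝕜 := ℝ) U (WithLp.toLp 2 y)) t =
      inner ℝ c t +
        inner ℝ (WithLp.toLp 2 y) (WithLp.toLp 2 (Uᵀ *ᵥ t) : EuclideanSpace ℝ (Fin d)) := by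
    intro y
    rw [inner_add_left]
    congr 1
    simp only [EuclideanSpace.inner_eq_star_dotProduct, Matrix.ofLp_toEuclideanCLM, star_trivial]
    rw [Matrix.dotProduct_mulVec, ← Matrix.mulVec_transpose]
  have hpi := charFun_pi (μ := fun i => gaussianReal 0 (l i))
    (WithLp.toLp 2 (Uᵀ *ᵥ t) : EuclideanSpace ℝ (Fin d))
  rw [charFun_apply, integral_map (by fun_prop) (by fun_prop)] at hpi
  simp_rw [hinner, Complex.ofReal_add, add_mul, Complex.exp_add]
  rw [integral_const_mul, hpi]
  simp_rw [charFun_gaussianReal]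
  rw [← Complex.exp_sum, ← Complex.exp_add, real_inner_comm]
  congr 1
  rw [sub_eq_add_neg]
  congr 1
  have hq : WithLp.ofLp t ⬝ᵥ S *ᵥ WithLp.ofLp t = ∑ i, (l i : ℝ) * (Uᵀ *ᵥ t) i ^ 2 := by
    rw [hS, ← Matrix.mulVec_mulVec, ← Matrix.mulVec_mulVec, Matrix.dotProduct_mulVec,
      ← Matrix.mulVec_transpose, dotProduct]
    refine Finset.sum_congr rfl fun i _ => ?_
    rw [Matrix.mulVec_diagonal]
    ring
  rw [hq]
  push_cast
  simp only [mul_zero, zero_mul, zero_sub, Finset.sum_neg_distrib, Finset.sum_div]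

/-- Change of measure from a Gaussian law to the Gaussian law with the same mean and identity
covariance (Donsker–Varadhan inequality with the explicit relative entropy). -/
theorem exp_integral_sub_kl_le {d : ℕ} (c : EuclideanSpace ℝ (Fin d))
    {S : Matrix (Fin d) (Fin d) ℝ} (hS : S.PosDef) {h : EuclideanSpace ℝ (Fin d) → ℝ}
    (hm : Measurable h) {a b : ℝ} (hab : ∀ x, h x ∈ Set.Icc a b) :
    ENNReal.ofReal (Real.exp (∫ x, h x ∂multivariateGaussian c S -
      (S.trace - d - Real.log S.det) / 2)) ≤
      ∫⁻ x, ENNReal.ofReal (Real.exp (h x)) ∂multivariateGaussian c 1 := by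
  obtain ⟨U, l, h1, h2, hl, hSU⟩ := PosDef.exists_diagonalization hS
  lift l to Fin d → ℝ≥0 using fun i => (hl i).le
  have hl0 : ∀ i, l i ≠ 0 := fun i => by simpa using (hl i).ne'
  set φ : (Fin d → ℝ) → EuclideanSpace ℝ (Fin d) :=
    fun y => c + Matrix.toEuclideanCLM (𝕜 := ℝ) U (WithLp.toLp 2 y) with hφ
  have hφm : Measurable φ := by fun_prop
  set ν := Measure.pi fun i => gaussianReal 0 (l i) with hν
  have hQ : multivariateGaussian c S = ν.map φ :=
    multivariateGaussian_eq_map_pi c l hSU hS.posSemidef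
  -- Since `U Uᵀ = 1`, the same map `φ` also produces the prior from a standard product law, so only
  -- product laws need comparing.
  have hP : multivariateGaussian c 1 = (Measure.pi fun _ : Fin d => gaussianReal 0 1).map φ :=
    multivariateGaussian_eq_map_pi c (fun _ => 1) (by simp [h2]) Matrix.PosSemidef.one
  have hD : (Measure.pi fun _ : Fin d => gaussianReal 0 1) =
      ν.withDensity fun y => ∏ i, ENNReal.ofReal (Real.exp (logDensity (l i) (y i))) := by
    have : ∀ i, SigmaFinite ((gaussianReal 0 (l i)).withDensity
        fun y => ENNReal.ofReal (Real.exp (logDensity (l i) y))) := fun i => by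
      rw [← gaussianReal_one_eq_withDensity (hl0 i)]
      infer_instance
    have hlm : ∀ i, Measurable fun y => ENNReal.ofReal (Real.exp (logDensity (l i) y)) :=
      fun i => by unfold logDensity; fun_prop
    rw [hν, ← pi_withDensity (fun i => gaussianReal 0 (l i)) hlm]
    congr 1
    ext1 i
    exact gaussianReal_one_eq_withDensity (hl0 i)
  -- The density of the prior is absorbed into the exponent. The integral of `g` is then that of `h`
  -- minus the relative entropy, and Jensen for `exp` gives the inequality.
  set g : (Fin d → ℝ) → ℝ := fun y => h (φ y) + ∑ i, logDensity (l i) (y i) with hg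
  have hgm : Measurable g := by
    have : ∀ i, Measurable (logDensity (l i)) := fun i => by unfold logDensity; fun_prop
    fun_prop
  have hint : ∫⁻ x, ENNReal.ofReal (Real.exp (h x)) ∂multivariateGaussian c 1 =
      ∫⁻ y, ENNReal.ofReal (Real.exp (g y)) ∂ν := by
    rw [hP, lintegral_map (by fun_prop) hφm, hD, lintegral_withDensity_eq_lintegral_mul _
      (by unfold logDensity; fun_prop) (by fun_prop)]
    refine lintegral_congr fun y => ?_
    rw [Pi.mul_apply, ← ENNReal.ofReal_prod_of_nonneg fun i _ => (Real.exp_pos _).le,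
      ← ENNReal.ofReal_mul (Finset.prod_nonneg fun i _ => (Real.exp_pos _).le), ← Real.exp_sum,
      ← Real.exp_add, add_comm]
  have hfin : ∫⁻ x, ENNReal.ofReal (Real.exp (h x)) ∂multivariateGaussian c 1 < ∞ := by
    refine (lintegral_mono fun x => ENNReal.ofReal_le_ofReal
      (Real.exp_le_exp.2 (hab x).2)).trans_lt ?_
    simp
  have hexp : Integrable (fun y => Real.exp (g y)) ν := by
    refine ⟨by fun_prop, ?_⟩
    rw [hasFiniteIntegral_iff_ofReal (Eventually.of_forall fun _ => (Real.exp_pos _).le), ← hint]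
    exact hfin
  have hi1 : Integrable (fun y => h (φ y)) ν :=
    Integrable.of_mem_Icc a b (by fun_prop) (Eventually.of_forall fun y => hab _)
  have hi2 : ∀ i, Integrable (fun y : Fin d → ℝ => logDensity (l i) (y i)) ν := fun i =>
    (measurePreserving_eval (fun i => gaussianReal 0 (l i)) i).integrable_comp_of_integrable
      (integrable_logDensity (l i))
  have hgi : Integrable g ν := hi1.add (integrable_finsetSum _ fun i _ => hi2 i)
  have hgint : ∫ y, g y ∂ν =
      ∫ x, h x ∂multivariateGaussian c S - (S.trace - d - Real.log S.det) / 2 := by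
    rw [integral_add hi1 (integrable_finsetSum _ fun i _ => hi2 i),
      integral_finsetSum _ fun i _ => hi2 i, hQ, integral_map (by fun_prop) (by fun_prop),
      sub_eq_add_neg]
    congr 1
    have htr : S.trace = ∑ i, (l i : ℝ) := by
      rw [hSU, Matrix.trace_mul_comm, ← Matrix.mul_assoc, h1, Matrix.one_mul,
        Matrix.trace_diagonal]
    have hdet : S.det = ∏ i, (l i : ℝ) := by
      have := congrArg Matrix.det h1
      rw [Matrix.det_mul, Matrix.det_one] at this
      rw [hSU, Matrix.det_mul, Matrix.det_mul, Matrix.det_diagonal]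
      linear_combination (∏ i, (l i : ℝ)) * this
    have : ∀ i, ∫ y : Fin d → ℝ, logDensity (l i) (y i) ∂ν =
        (Real.log (l i) + 1 - l i) / 2 := fun i => by
      rw [← integral_logDensity (hl0 i)]
      exact integral_comp_eval (μ := fun i => gaussianReal 0 (l i)) (i := i)
        (integrable_logDensity (l i)).aestronglyMeasurable
    simp_rw [this]
    rw [htr, hdet, Real.log_prod fun i _ => (hl i).ne', ← Finset.sum_div, Finset.sum_sub_distrib,
      Finset.sum_add_distrib]
    simp
    ring
  rw [hint, ← hgint, ← ofReal_integral_eq_lintegral_ofReal hexp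
    (Eventually.of_forall fun _ => (Real.exp_pos _).le)]
  refine ENNReal.ofReal_le_ofReal ?_
  exact convexOn_exp.map_integral_le Real.continuous_exp.continuousOn isClosed_univ
    (Eventually.of_forall fun _ => trivial) hgi hexp

/-! ### A PAC-Bayes bound for independent samples -/

/-- Rewritten as an integral against `N(0, v)`, the quadratic exponents cancel and the integrand is
the constant `√v`. -/
lemma lintegral_exp_sq_gaussianReal {v : ℝ≥0} (hv : v ≠ 0) :
    ∫⁻ y, ENNReal.ofReal (Real.exp ((1 - 1 / (v : ℝ)) * y ^ 2 / 2)) ∂gaussianReal 0 1 =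
      ENNReal.ofReal √v := by
  have hv' : (0 : ℝ) < v := by positivity
  rw [gaussianReal_one_eq_withDensity hv, lintegral_withDensity_eq_lintegral_mul _
    (by unfold logDensity; fun_prop) (by fun_prop)]
  have : ∀ y : ℝ, ENNReal.ofReal (Real.exp (logDensity v y)) *
      ENNReal.ofReal (Real.exp ((1 - 1 / (v : ℝ)) * y ^ 2 / 2)) = ENNReal.ofReal √v := by
    intro y
    rw [← ENNReal.ofReal_mul (Real.exp_pos _).le, ← Real.exp_add, Real.sqrt_eq_rpow,
      Real.rpow_def_of_pos hv', logDensity]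
    congr 2
    field_simp
    ring
  simp only [Pi.mul_apply, this, lintegral_const, measure_univ, mul_one]

/-- The exponential of the square of a sub-Gaussian random variable. -/
lemma lintegral_exp_sq_le_of_hasSubgaussianMGF {Ω : Type*} [MeasurableSpace Ω] {μ : Measure Ω}
    [IsProbabilityMeasure μ] {X : Ω → ℝ} (hXm : Measurable X) {c v : ℝ≥0}
    (hX : HasSubgaussianMGF X c μ) (hv : v ≠ 0) {a : ℝ} (ha : 0 ≤ a)
    (hav : 2 * a * c = 1 - 1 / (v : ℝ)) :
    ∫⁻ ω, ENNReal.ofReal (Real.exp (a * X ω ^ 2)) ∂μ ≤ ENNReal.ofReal √v := by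
  have hb : √(2 * a) ^ 2 = 2 * a := Real.sq_sqrt (by positivity)
  -- Gaussian linearization: the square in the exponent becomes an average of linear exponents, to
  -- which the sub-Gaussian bound applies after exchanging the integrals.
  have hg : ∀ x : ℝ, ENNReal.ofReal (Real.exp (a * x ^ 2)) =
      ∫⁻ y, ENNReal.ofReal (Real.exp (√(2 * a) * x * y)) ∂gaussianReal 0 1 := by
    intro x
    rw [← ofReal_integral_eq_lintegral_ofReal (integrable_exp_mul_gaussianReal _)
      (Eventually.of_forall fun _ => (Real.exp_pos _).le)]
    have := mgf_gaussianReal (p := gaussianReal 0 1) (X := id) Measure.map_id (√(2 * a) * x)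
    simp only [mgf, id] at this
    rw [this, mul_pow, hb]
    congr 2
    push_cast
    ring
  simp_rw [hg]
  rw [lintegral_lintegral_swap (by fun_prop), ← lintegral_exp_sq_gaussianReal hv]
  refine lintegral_mono fun y => ?_
  have h1 : ∀ ω, √(2 * a) * X ω * y = √(2 * a) * y * X ω := fun ω => by ring
  simp_rw [h1]
  rw [← ofReal_integral_eq_lintegral_ofReal (hX.integrable_exp_mul _)
    (Eventually.of_forall fun _ => (Real.exp_pos _).le)]
  refine ENNReal.ofReal_le_ofReal ((hX.mgf_le _).trans_eq ?_)
  congr 1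
  rw [mul_pow, hb, ← hav]
  ring

/-- The difference of the expected and the empirical mean of independent samples. -/
noncomputable def meanGap {ι : Type*} [Fintype ι] {Z : Type*} [MeasurableSpace Z]
    (μ : ι → Measure Z) (f : Z → ℝ) (S : ι → Z) : ℝ :=
  (Fintype.card ι : ℝ)⁻¹ * ∑ p, (∫ z, f z ∂μ p - f (S p))

lemma measurable_meanGap {ι : Type*} [Fintype ι] {Z : Type*} [MeasurableSpace Z]
    (μ : ι → Measure Z) {f : Z → ℝ} (hf : Measurable f) : Measurable (meanGap μ f) := by
  unfold meanGap
  fun_prop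

lemma measurable_meanGap_prod {ι : Type*} [Fintype ι] {Z : Type*} [MeasurableSpace Z]
    (μ : ι → Measure Z) [∀ p, IsProbabilityMeasure (μ p)] {Θ : Type*} [MeasurableSpace Θ]
    {F : Θ → Z → ℝ} (hF : Measurable fun p : Θ × Z => F p.1 p.2) :
    Measurable fun q : (ι → Z) × Θ => meanGap μ (F q.2) q.1 := by
  have h1 : ∀ p, Measurable fun θ => ∫ z, F θ z ∂μ p := fun p =>
    (hF.stronglyMeasurable.integral_prod_right (ν := μ p)).measurable
  have h2 : ∀ p, Measurable fun q : (ι → Z) × Θ => F q.2 (q.1 p) := fun p =>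
    hF.comp (by fun_prop : Measurable fun q : (ι → Z) × Θ => (q.2, q.1 p))
  unfold meanGap
  exact (Finset.measurable_sum _ fun p _ =>
    ((h1 p).comp measurable_snd).sub (h2 p)).const_mul _

lemma lintegral_exp_sq_meanGap_le {ι : Type*} [Fintype ι] [Nonempty ι] {Z : Type*}
    [MeasurableSpace Z] (μ : ι → Measure Z) [∀ p, IsProbabilityMeasure (μ p)] {f : Z → ℝ}
    (hf : Measurable f) (hf01 : ∀ z, f z ∈ Set.Icc (0 : ℝ) 1) :
    ∫⁻ S, ENNReal.ofReal (Real.exp ((2 * Fintype.card ι - 1) * meanGap μ f S ^ 2))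
      ∂Measure.pi μ ≤ ENNReal.ofReal √(2 * Fintype.card ι) := by
  have hN : (1 : ℝ) ≤ Fintype.card ι := by exact_mod_cast Fintype.card_pos
  have hind : iIndepFun (fun p (S : ι → Z) => ∫ z, f z ∂μ p - f (S p)) (Measure.pi μ) :=
    iIndepFun_pi (X := fun p z => ∫ z, f z ∂μ p - f z) fun p => by fun_prop
  have hsub : ∀ p ∈ Finset.univ, HasSubgaussianMGF
      (fun S : ι → Z => ∫ z, f z ∂μ p - f (S p)) ((‖(1 : ℝ) - 0‖₊ / 2) ^ 2) (Measure.pi μ) := by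
    intro p _
    have h := (hasSubgaussianMGF_of_mem_Icc (μ := Measure.pi μ) (X := fun S : ι → Z => f (S p))
      (a := 0) (b := 1) (hf.comp (measurable_pi_apply p)).aemeasurable
      (Eventually.of_forall fun S => hf01 (S p))).neg
    have he : ∫ S : ι → Z, f (S p) ∂Measure.pi μ = ∫ z, f z ∂μ p :=
      integral_comp_eval (μ := μ) (i := p) hf.aestronglyMeasurable
    rw [he] at h
    convert! h using 1
    ext S
    simp
  have hsum : HasSubgaussianMGF (meanGap μ f) (NNReal.mk ((Fintype.card ι : ℝ)⁻¹ ^ 2)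
      (sq_nonneg _) * ∑ _ : ι, (‖(1 : ℝ) - 0‖₊ / 2) ^ 2) (Measure.pi μ) :=
    (HasSubgaussianMGF.sum_of_iIndepFun hind hsub).const_mul (Fintype.card ι : ℝ)⁻¹
  -- With parameter `c = 1/(4N)` and `a = 2N - 1`, one has `2ac = 1 - 1/(2N)`, which forces `v =
  -- 2N`.
  have := lintegral_exp_sq_le_of_hasSubgaussianMGF (X := meanGap μ f) (measurable_meanGap μ hf)
    hsum (v := 2 * Fintype.card ι) (by simp) (a := 2 * Fintype.card ι - 1) (by linarith) ?_
  · simpa using this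
  · rw [NNReal.coe_mul, NNReal.coe_mk]
    simp
    field_simp

lemma meanGap_mem_Icc {ι : Type*} [Fintype ι] [Nonempty ι] {Z : Type*} [MeasurableSpace Z]
    (μ : ι → Measure Z) [∀ p, IsProbabilityMeasure (μ p)] {f : Z → ℝ} (hf : Measurable f)
    (hf01 : ∀ z, f z ∈ Set.Icc (0 : ℝ) 1) (S : ι → Z) : meanGap μ f S ∈ Set.Icc (-1 : ℝ) 1 := by
  have hN : (0 : ℝ) < Fintype.card ι := by exact_mod_cast Fintype.card_pos
  have hp : ∀ p, |∫ z, f z ∂μ p - f (S p)| ≤ 1 := by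
    intro p
    have h0 : 0 ≤ ∫ z, f z ∂μ p := integral_nonneg fun z => (hf01 z).1
    have h1 : ∫ z, f z ∂μ p ≤ 1 := by
      have := integral_mono (μ := μ p)
        (Integrable.of_mem_Icc 0 1 hf.aemeasurable (Eventually.of_forall hf01))
        (integrable_const 1) fun z => (hf01 z).2
      simpa using this
    have := hf01 (S p)
    rw [abs_le]
    constructor <;> linarith [this.1, this.2]
  rw [Set.mem_Icc, ← abs_le, meanGap, abs_mul, abs_of_pos (inv_pos.2 hN), inv_mul_le_iff₀ hN,
    mul_one]
  refine (Finset.abs_sum_le_sum_abs _ _).trans ?_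
  refine (Finset.sum_le_sum fun p _ => hp p).trans ?_
  simp

/-- With probability `1 - δ` over independent samples, the exponential moment of the squared gap
under a prior is controlled. -/
theorem exists_event_lintegral_exp_sq_meanGap_le {ι : Type*} [Fintype ι] [Nonempty ι] {Z : Type*}
    [MeasurableSpace Z] (μ : ι → Measure Z) [∀ p, IsProbabilityMeasure (μ p)]
    {Θ : Type*} [MeasurableSpace Θ] (P : Measure Θ) [IsProbabilityMeasure P]
    {F : Θ → Z → ℝ} (hF : Measurable fun p : Θ × Z => F p.1 p.2)
    (hF01 : ∀ θ z, F θ z ∈ Set.Icc (0 : ℝ) 1) {δ : ℝ} (hδ : 0 < δ) :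
    ∃ G : Set (ι → Z), MeasurableSet G ∧ ENNReal.ofReal (1 - δ) ≤ Measure.pi μ G ∧
      ∀ S ∈ G, ∫⁻ θ, ENNReal.ofReal
        (Real.exp ((2 * Fintype.card ι - 1) * meanGap μ (F θ) S ^ 2)) ∂P ≤
          ENNReal.ofReal (√(2 * Fintype.card ι) / δ) := by
  have hN : (0 : ℝ) < Fintype.card ι := by exact_mod_cast Fintype.card_pos
  have hgm := measurable_meanGap_prod μ hF
  set W : (ι → Z) → ℝ≥0∞ := fun S => ∫⁻ θ, ENNReal.ofReal
    (Real.exp ((2 * Fintype.card ι - 1) * meanGap μ (F θ) S ^ 2)) ∂P with hW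
  have hWm : Measurable W := by
    refine Measurable.lintegral_prod_right' (f := fun q : (ι → Z) × Θ => ENNReal.ofReal
      (Real.exp ((2 * Fintype.card ι - 1) * meanGap μ (F q.2) q.1 ^ 2))) ?_
    fun_prop
  have hWint : ∫⁻ S, W S ∂Measure.pi μ ≤ ENNReal.ofReal √(2 * Fintype.card ι) := by
    -- The prior does not depend on the sample, so the integrals can be exchanged and the bound for
    -- a fixed `θ` applies.
    rw [hW, lintegral_lintegral_swap (by
      refine Measurable.aemeasurable (?_ : Measurable fun q : (ι → Z) × Θ => ENNReal.ofReal
        (Real.exp ((2 * Fintype.card ι - 1) * meanGap μ (F q.2) q.1 ^ 2)))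
      fun_prop)]
    calc _ ≤ ∫⁻ _, ENNReal.ofReal √(2 * Fintype.card ι) ∂P :=
          lintegral_mono fun θ => lintegral_exp_sq_meanGap_le μ
            (hF.comp measurable_prodMk_left) (hF01 θ)
      _ = _ := by simp
  set ε := ENNReal.ofReal (√(2 * Fintype.card ι) / δ) with hε
  have hG : MeasurableSet {S | W S ≤ ε} := hWm measurableSet_Iic
  refine ⟨{S | W S ≤ ε}, hG, ?_, fun S hS => hS⟩
  have hsq : 0 < √(2 * (Fintype.card ι : ℝ)) := by positivity
  have hε0 : ε ≠ 0 := by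
    rw [hε, Ne, ENNReal.ofReal_eq_zero, not_le]
    positivity
  -- Markov's inequality; the level `ε` is the bound on the mean divided by `δ`.
  have hc : Measure.pi μ {S | W S ≤ ε}ᶜ ≤ ENNReal.ofReal δ := by
    calc Measure.pi μ {S | W S ≤ ε}ᶜ ≤ Measure.pi μ {S | ε ≤ W S} :=
          measure_mono fun S (hS : ¬ W S ≤ ε) => (not_le.1 hS).le
      _ ≤ ENNReal.ofReal √(2 * Fintype.card ι) / ε := by
          rw [ENNReal.le_div_iff_mul_le (Or.inl hε0) (Or.inl ENNReal.ofReal_ne_top), mul_comm]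
          exact (mul_meas_ge_le_lintegral hWm ε).trans hWint
      _ = ENNReal.ofReal δ := by
          rw [hε, ← ENNReal.ofReal_div_of_pos (by positivity)]
          congr 1
          field_simp
  rw [ENNReal.ofReal_sub _ hδ.le, ENNReal.ofReal_one, tsub_le_iff_right]
  calc (1 : ℝ≥0∞) = Measure.pi μ {S | W S ≤ ε} + Measure.pi μ {S | W S ≤ ε}ᶜ := by
        rw [measure_add_measure_compl hG, measure_univ]
    _ ≤ _ := by gcongr

/-! ### Risks and gaps -/

lemma natCast_sum_ne_zero {n : ℕ} (M : Fin n → ℕ) [Nonempty (Σ i, Fin (M i))] :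
    ((∑ i, M i : ℕ) : ℝ≥0∞) ≠ 0 := by
  obtain ⟨p⟩ := ‹Nonempty (Σ i, Fin (M i))›
  have h1 := Finset.single_le_sum (f := M) (fun _ _ => Nat.zero_le _) (Finset.mem_univ p.1)
  have h2 := p.2.2
  exact_mod_cast (by omega : ∑ i, M i ≠ 0)

/-- The mixture weights count each client once per sample it holds, so the test mean is the average
over all samples of the mean under the sample's own law. Hence different client laws cause no bias.
-/
lemma integral_testLaw_sub_integral_empLaw {n : ℕ} {M : Fin n → ℕ} {Z : Type*} [MeasurableSpace Z]
    [Nonempty (Σ i, Fin (M i))] (D : Fin n → Measure Z) [∀ i, IsProbabilityMeasure (D i)]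
    {f : Z → ℝ} (hf : Measurable f)
    (hf01 : ∀ z, f z ∈ Set.Icc (0 : ℝ) 1) (S : (Σ i, Fin (M i)) → Z) :
    ∫ z, f z ∂testLaw M D - ∫ z, f z ∂empLaw S =
      meanGap (fun p : Σ i, Fin (M i) => D p.1) f S := by
  have hint : ∀ (μ : Measure Z) [IsFiniteMeasure μ], Integrable f μ := fun μ _ =>
    Integrable.of_mem_Icc 0 1 hf.aemeasurable (Eventually.of_forall hf01)
  have hcard : (Fintype.card (Σ i, Fin (M i)) : ℝ) = ((∑ i, M i : ℕ) : ℝ) := by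
    rw [Fintype.card_sigma]
    simp
  have hM' := natCast_sum_ne_zero M
  have h1 : ∫ z, f z ∂testLaw M D =
      ((∑ i, M i : ℕ) : ℝ)⁻¹ * ∑ p : Σ i, Fin (M i), ∫ z, f z ∂D p.1 := by
    rw [testLaw, integral_finsetSum_measure fun i _ =>
      (hint (D i)).smul_measure (ENNReal.div_ne_top (by simp) hM'), Fintype.sum_sigma,
      Finset.mul_sum]
    refine Finset.sum_congr rfl fun i _ => ?_
    rw [integral_smul_measure, ENNReal.toReal_div, ENNReal.toReal_natCast, ENNReal.toReal_natCast]
    simp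
    ring
  have h2 : ∫ z, f z ∂empLaw S = ((∑ i, M i : ℕ) : ℝ)⁻¹ * ∑ p, f (S p) := by
    rw [empLaw, integral_smul_measure, integral_finsetSum_measure fun i _ => hint _,
      ENNReal.toReal_inv, ENNReal.toReal_natCast, smul_eq_mul]
    simp_rw [integral_dirac' f _ hf.stronglyMeasurable]
  rw [h1, h2, meanGap, hcard, Finset.sum_sub_distrib, mul_sub]

instance isProbabilityMeasure_empLaw {n : ℕ} {M : Fin n → ℕ} {Z : Type*} [MeasurableSpace Z]
    [Nonempty (Σ i, Fin (M i))] (S : (Σ i, Fin (M i)) → Z) : IsProbabilityMeasure (empLaw S) := by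
  constructor
  have : (Finset.univ : Finset (Σ i, Fin (M i))).card = ∑ i, M i := by
    rw [Finset.card_univ, Fintype.card_sigma]
    simp
  have h0 := natCast_sum_ne_zero M
  rw [empLaw, Measure.smul_apply, Measure.finsetSum_apply]
  simp only [measure_univ, Finset.sum_const, this, nsmul_eq_mul, mul_one, smul_eq_mul]
  exact ENNReal.inv_mul_cancel h0 (ENNReal.natCast_ne_top _)

instance isProbabilityMeasure_testLaw {n : ℕ} {M : Fin n → ℕ} {Z : Type*} [MeasurableSpace Z]
    [Nonempty (Σ i, Fin (M i))] (D : Fin n → Measure Z) [∀ i, IsProbabilityMeasure (D i)] :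
    IsProbabilityMeasure (testLaw M D) := by
  constructor
  have h0 := natCast_sum_ne_zero M
  rw [testLaw, Measure.finsetSum_apply]
  simp only [Measure.smul_apply, measure_univ, smul_eq_mul, mul_one, div_eq_mul_inv]
  rw [← Finset.sum_mul, ← Nat.cast_sum]
  exact ENNReal.mul_inv_cancel h0 (ENNReal.natCast_ne_top _)

lemma risk_testLaw_sub_risk_empLaw {d n : ℕ} {M : Fin n → ℕ} {Z : Type*} [MeasurableSpace Z]
    [Nonempty (Σ i, Fin (M i))] (D : Fin n → Measure Z) [∀ i, IsProbabilityMeasure (D i)]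
    {F : EuclideanSpace ℝ (Fin d) → Z → ℝ}
    (hF : Measurable fun p : EuclideanSpace ℝ (Fin d) × Z => F p.1 p.2)
    (hF01 : ∀ θ z, F θ z ∈ Set.Icc (0 : ℝ) 1) (S : (Σ i, Fin (M i)) → Z)
    (Q : Measure (EuclideanSpace ℝ (Fin d))) [IsProbabilityMeasure Q] :
    risk F (testLaw M D) Q - risk F (empLaw S) Q =
      ∫ θ, meanGap (fun p : Σ i, Fin (M i) => D p.1) (F θ) S ∂Q := by
  have hint : ∀ (μ : Measure Z) [IsProbabilityMeasure μ],
      Integrable (fun θ => ∫ z, F θ z ∂μ) Q := by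
    intro μ _
    refine Integrable.of_mem_Icc 0 1
      (hF.stronglyMeasurable.integral_prod_right (ν := μ)).measurable.aemeasurable
      (Eventually.of_forall fun θ => ⟨integral_nonneg fun z => (hF01 θ z).1, ?_⟩)
    have := integral_mono (μ := μ) (Integrable.of_mem_Icc 0 1
      (hF.comp measurable_prodMk_left).aemeasurable (Eventually.of_forall (hF01 θ)))
      (integrable_const 1) fun z => (hF01 θ z).2
    simpa using this
  rw [risk, risk, ← integral_sub (hint _) (hint _)]
  exact integral_congr_ae (Eventually.of_forall fun θ =>
    integral_testLaw_sub_integral_empLaw D (hF.comp measurable_prodMk_left) (hF01 θ) S)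

/-- The squared expected gap under a Gaussian posterior is bounded by the relative entropy. -/
theorem sq_integral_meanGap_le {d : ℕ} {ι : Type*} [Fintype ι] [Nonempty ι] {Z : Type*}
    [MeasurableSpace Z] (μ : ι → Measure Z) [∀ p, IsProbabilityMeasure (μ p)]
    {F : EuclideanSpace ℝ (Fin d) → Z → ℝ}
    (hF : Measurable fun p : EuclideanSpace ℝ (Fin d) × Z => F p.1 p.2)
    (hF01 : ∀ θ z, F θ z ∈ Set.Icc (0 : ℝ) 1) {δ : ℝ} (hδ : 0 < δ) (S : ι → Z)
    (c : EuclideanSpace ℝ (Fin d)) {V : Matrix (Fin d) (Fin d) ℝ} (hV : V.PosDef)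
    (hS : ∫⁻ θ, ENNReal.ofReal
        (Real.exp ((2 * Fintype.card ι - 1) * meanGap μ (F θ) S ^ 2)) ∂multivariateGaussian c 1 ≤
          ENNReal.ofReal (√(2 * Fintype.card ι) / δ)) :
    (∫ θ, meanGap μ (F θ) S ∂multivariateGaussian c V) ^ 2 ≤
      (V.trace - d - Real.log V.det + 2 * Real.log (1 / δ) + 2 * Real.log (Fintype.card ι) + 4) /
        (4 * Fintype.card ι - 2) := by
  have hN : (1 : ℝ) ≤ Fintype.card ι := by exact_mod_cast Fintype.card_pos
  set N : ℝ := (Fintype.card ι : ℝ)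
  set g : EuclideanSpace ℝ (Fin d) → ℝ := fun θ => meanGap μ (F θ) S with hg
  have hgm : Measurable g := (measurable_meanGap_prod μ hF).comp measurable_prodMk_left
  have hgI : ∀ θ, g θ ∈ Set.Icc (-1 : ℝ) 1 := fun θ =>
    meanGap_mem_Icc μ (hF.comp measurable_prodMk_left) (hF01 θ) S
  have hg2 : ∀ θ, g θ ^ 2 ∈ Set.Icc (0 : ℝ) 1 := fun θ =>
    ⟨sq_nonneg _, by nlinarith [(hgI θ).1, (hgI θ).2]⟩
  have hDV := (exp_integral_sub_kl_le c hV (h := fun θ => (2 * N - 1) * g θ ^ 2) (by fun_prop)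
    (a := 0) (b := 2 * N - 1) fun θ => ⟨mul_nonneg (by linarith) (hg2 θ).1,
      mul_le_of_le_one_right (by linarith) (hg2 θ).2⟩).trans hS
  have hsq : 0 < √(2 * N) := by positivity
  rw [ENNReal.ofReal_le_ofReal_iff (by positivity), ← Real.le_log_iff_exp_le (by positivity),
    integral_const_mul, Real.log_div hsq.ne' hδ.ne', Real.log_sqrt (by positivity),
    Real.log_mul two_ne_zero (by positivity)] at hDV
  have hJ : (∫ θ, g θ ∂multivariateGaussian c V) ^ 2 ≤
      ∫ θ, g θ ^ 2 ∂multivariateGaussian c V := by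
    refine (even_two.convexOn_pow (𝕜 := ℝ)).map_integral_le (by fun_prop) isClosed_univ
      (Eventually.of_forall fun _ => trivial)
      (Integrable.of_mem_Icc (-1) 1 hgm.aemeasurable (Eventually.of_forall hgI))
      (Integrable.of_mem_Icc 0 1 (by fun_prop) (Eventually.of_forall hg2))
  -- The argument yields `log 2 + log N` after doubling; the stated `2 log N + 4` is larger because
  -- `log 2 ≤ 1` and `log N ≥ 0`.
  have hlog2 : Real.log 2 ≤ 1 := by linarith [Real.log_two_lt_d9]
  have hlogN : 0 ≤ Real.log N := Real.log_nonneg hN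
  rw [le_div_iff₀ (by linarith), one_div, Real.log_inv]
  nlinarith [mul_le_mul_of_nonneg_left hJ (by linarith : 0 ≤ 4 * N - 2)]

end FedPAC

/-! ### Covariance formula and generalization bound -/

theorem mainTheorem5
    {d n : ℕ} (M : Fin n → ℕ) (hM : 0 < ∑ i, M i)
    {Z : Type*} [MeasurableSpace Z]
    (D : Fin n → Measure Z) (hD : ∀ i, IsProbabilityMeasure (D i))
    (F : EuclideanSpace ℝ (Fin d) → Z → ℝ)
    (hF : Measurable fun p : EuclideanSpace ℝ (Fin d) × Z => F p.1 p.2)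
    (hF01 : ∀ θ z, F θ z ∈ Set.Icc (0 : ℝ) 1)
    (θs : EuclideanSpace ℝ (Fin d))
    (T : ℕ) (hT : 0 < T) (η : ℝ) (hη : 0 < η)
    (m : ℝ) (hm : m = FedPAC.avgSize M)
    (k : ℝ) (hk : k ∈ Set.Icc (1 / m) 1) :
    -- the covariance matrix of the stationary distribution
    (∀ (A B : Fin n → Matrix (Fin d) (Fin d) ℝ) (Q : Measure (EuclideanSpace ℝ (Fin d))),
      (∀ i, (A i).PosSemidef) →
      IsUnit (FedPAC.clientMean A).det →
      FedPAC.IsFedStationary θs A B T η (k * m) Q →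
      FedPAC.clientMean A * FedPAC.covMat Q = FedPAC.covMat Q * FedPAC.clientMean A →
      FedPAC.covMat Q
        = (T * η / (2 * k * m)) • (FedPAC.meanNoise B * (FedPAC.clientMean A)⁻¹)) ∧
    -- the generalization bound, simultaneously for all local models, which may therefore
    -- depend on the data set
    (∀ δ : ℝ, 0 < δ → δ < 1 →
      ∃ G : Set ((Σ i, Fin (M i)) → Z), MeasurableSet G ∧
        ENNReal.ofReal (1 - δ) ≤ FedPAC.trainLaw M D G ∧
        ∀ S ∈ G,
          ∀ (A B : Fin n → Matrix (Fin d) (Fin d) ℝ) (Q : Measure (EuclideanSpace ℝ (Fin d))),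
            (∀ i, (A i).PosSemidef) →
            IsUnit (FedPAC.clientMean A).det →
            IsUnit (FedPAC.meanNoise B).det →
            FedPAC.IsFedStationary θs A B T η (k * m) Q →
            FedPAC.clientMean A * FedPAC.covMat Q = FedPAC.covMat Q * FedPAC.clientMean A →
            FedPAC.risk F (FedPAC.testLaw M D) Q - FedPAC.risk F (FedPAC.empLaw S) Q
              ≤ √((d * Real.log (2 * k * m / (T * η))
                    - Real.log (FedPAC.meanNoise B * (FedPAC.clientMean A)⁻¹).det
                    + T * η / (2 * k * m)
                        * (FedPAC.meanNoise B * (FedPAC.clientMean A)⁻¹).trace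
                    - d + 2 * Real.log (1 / δ) + 2 * Real.log (n * m) + 4)
                  / (4 * n * m - 2))) := by
  have hMR : (1 : ℝ) ≤ ((∑ i, M i : ℕ) : ℝ) := by exact_mod_cast hM
  have hn : (n : ℝ) ≠ 0 := by
    rintro h
    have h0 : n = 0 := by exact_mod_cast h
    subst h0
    simp at hM
  have hnm : n * m = ((∑ i, M i : ℕ) : ℝ) := by
    rw [hm, FedPAC.avgSize]
    push_cast
    field_simp
  have hn' : (0 : ℝ) < n := lt_of_le_of_ne (Nat.cast_nonneg _) hn.symm
  have hmpos : 0 < m := by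
    by_contra h
    nlinarith [mul_nonneg hn'.le (neg_nonneg.2 (not_lt.1 h))]
  have hkpos : 0 < k := (one_div_pos.2 hmpos).trans_le hk.1
  have hs : 0 < k * m := mul_pos hkpos hmpos
  have hTR : (0 : ℝ) < T := by exact_mod_cast hT
  have hr : 0 < T * η / (2 * k * m) := by positivity
  refine ⟨fun A B Q hA hdet hQ hcomm => ?_, fun δ hδ _ => ?_⟩
  · rw [(hQ.eq_multivariateGaussian hT hη hs hA hdet hcomm).2.2, mul_assoc]
  have hcardN : Fintype.card (Σ i, Fin (M i)) = ∑ i, M i := by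
    rw [Fintype.card_sigma]
    simp
  have : Nonempty (Σ i, Fin (M i)) := Fintype.card_pos_iff.1 (by omega)
  have hcard : (Fintype.card (Σ i, Fin (M i)) : ℝ) = n * m := by rw [hnm, hcardN]
  -- The prior is centered at the fixed point `θ*`, the mean of every stationary law, so the
  -- relative entropy has no mean term.
  obtain ⟨G, hGm, hGp, hG⟩ := FedPAC.exists_event_lintegral_exp_sq_meanGap_le
    (fun p : Σ i, Fin (M i) => D p.1) (multivariateGaussian θs 1) hF hF01 hδ
  refine ⟨G, hGm, hGp, fun S hS A B Q hA hdetA hdetC hQ hcomm => ?_⟩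
  obtain ⟨hpsd, hQG, hcov⟩ := hQ.eq_multivariateGaussian hT hη hs hA hdetA hcomm
  rw [← mul_assoc 2 k m] at hcov
  set X := FedPAC.meanNoise B * (FedPAC.clientMean A)⁻¹ with hX
  have hXdet : X.det ≠ 0 := by
    rw [hX, Matrix.det_mul]
    exact mul_ne_zero hdetC.ne_zero (Matrix.isUnit_nonsing_inv_det _ hdetA).ne_zero
  -- Invertibility of `C̄` enters here: it makes the posterior nondegenerate, as the relative
  -- entropy formula requires.
  have hpd : (FedPAC.covMat Q).PosDef := by
    rw [hpsd.posDef_iff_isUnit, Matrix.isUnit_iff_isUnit_det, hcov, Matrix.det_smul]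
    exact (mul_ne_zero (pow_ne_zero _ hr.ne') hXdet).isUnit
  have hQp : IsProbabilityMeasure Q := hQ.1
  rw [FedPAC.risk_testLaw_sub_risk_empLaw D hF hF01 S Q]
  refine Real.le_sqrt_of_sq_le ?_
  have hbound := FedPAC.sq_integral_meanGap_le (fun p : Σ i, Fin (M i) => D p.1) hF hF01 hδ S θs
    hpd (hG S hS)
  rw [← hQG, hcard, hcov, Matrix.trace_smul, Matrix.det_smul, Fintype.card_fin,
    Real.log_mul (pow_ne_zero _ hr.ne') hXdet, Real.log_pow, smul_eq_mul] at hbound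
  have hlog : Real.log (2 * k * m / (T * η)) = -Real.log (T * η / (2 * k * m)) := by
    rw [← Real.log_inv, inv_div]
  rw [hlog]
  refine hbound.trans_eq ?_
  rw [mul_assoc 4 (n : ℝ) m]
  congr 1
  ring
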